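/- Let $C([0,1])$ be the Polish space of continuous functions $[0,1]\to\mathbb{R}$ with the uniform metric. A function $f:[0,1]\to\mathbb{R}$ is called solvable if it is of class Baire one (a pointwise limit of a sequence of continuous functions) and, for every closed set $K\subseteq[0,1]$, the set of discontinuity points of the restriction $f\restriction_K$ is closed. For $J\subseteq\mathbb{R}$ let $\mathcal{D}_J\subseteq C([0,1])$ be the set of functions $y:[0,1]\to J$ that are differentiable at every point of $[0,1]$ (one-sidedly at $0$ and $1$), and let $SV_J$ be the set of all $y\in\mathcal{D}_J$ whose derivative $y':[0,1]\to\mathbb{R}$ is bounded and solvable. Then, both for $J=[0,1]$ and for $J=\mathbb{R}$, the set $SV_J$ is a $\boldsymbol{\Pi}^1_1$ (coanalytic) subset of $C([0,1])$ which is not Borel. -/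

import Mathlib

open Set Topology Filter
open scoped MeasureTheory

/-- A function of class Baire one: a pointwise limit of a sequence of continuous functions. -/
def IsBaireOne {X Y : Type*} [TopologicalSpace X] [TopologicalSpace Y] (f : X → Y) : Prop :=
  ∃ F : ℕ → C(X, Y), ∀ x, Tendsto (fun n => F n x) atTop (𝓝 (f x))

/-- The set of discontinuity points of the restriction of `f` to `K`, where `K` carries the
induced topology. -/
def discontinuitySet {X Y : Type*} [TopologicalSpace X] [TopologicalSpace Y] (f : X → Y)
    (K : Set X) : Set X :=
  {x ∈ K | ¬ ContinuousWithinAt f K x}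

/-- A solvable function: a Baire one function such that for every closed set `K` the set of
discontinuity points of the restriction of `f` to `K` is closed. -/
def IsSolvableFunction {X Y : Type*} [TopologicalSpace X] [TopologicalSpace Y] (f : X → Y) : Prop :=
  IsBaireOne f ∧ ∀ K : Set X, IsClosed K → IsClosed (discontinuitySet f K)

/-- The derivative of a function on `[0,1]`, one-sided at the end points (its value is meaningful
only at points where `y` is differentiable). -/
noncomputable def unitDeriv (y : C(unitInterval, ℝ)) (x : unitInterval) : ℝ :=
  derivWithin (IccExtend zero_le_one y) (Icc 0 1) (x : ℝ)

/-- The functions `[0,1] → J` that are differentiable at every point of `[0,1]` (one-sidedly at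
the end points). -/
def differentiableFunctions (J : Set ℝ) : Set C(unitInterval, ℝ) :=
  {y | (∀ x, y x ∈ J) ∧ DifferentiableOn ℝ (IccExtend zero_le_one y) (Icc 0 1)}

/-- The differentiable functions `[0,1] → J` with bounded solvable derivative. -/
def solvableFunctions (J : Set ℝ) : Set C(unitInterval, ℝ) :=
  {y ∈ differentiableFunctions J |
    Bornology.IsBounded (range (unitDeriv y)) ∧ IsSolvableFunction (unitDeriv y)}

/-- Coanalytic sets (boldface `Π¹₁` sets) of a Polish space: complements of analytic sets. -/
def IsCoanalytic {X : Type*} [TopologicalSpace X] [PolishSpace X] (s : Set X) : Prop :=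
  MeasureTheory.AnalyticSet sᶜ

/-! Upper bound: if the discontinuities of `f` restricted to some closed `K` fail to be closed,
countably many points already show it: a point `x`, points `u n` tending to `x`, and for each `n`
points `z n m` tending to `u n`, such that `f` jumps at `u n` along `z n` while its values at all
these points approach `f x`. As `unitDeriv y x` is jointly Borel in `(y, x)`, the existence of such
a configuration is an analytic condition on `y`. Failures of differentiability, boundedness or
membership in `J` are analytic too, and a derivative is automatically Baire one.

Lower bound: each set `T` of finite sequences yields a differentiable function whose bounded slope
is self-similar: near `0` it is `1/4` plus half a rescaled copy of the slope of the `n`-th subtree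
on the `n`-th cell, the cells shrinking to `0`. If `T` has no branch, solvability propagates from
the subtrees to `T` (`hasSolvableSlope_of_subtree`), because discontinuities other than `0` have
slope at least `3/8`, whereas the slope at `0` is `1/4`. Along a branch, the slopes at the
successive cell centres are discontinuous there but converge to `1/2`, the slope at the limit point,
so solvability fails (`exists_isOscillationWitness_of_branch`). Thus `treeFunction` reduces the
absence of a branch to solvability. By diagonalization over codes of analytic sets, absence of a
branch is not analytic for `diagonalTree`; a Borel set of solvable functions would make it Borel. -/

/-! ### Countable witnesses for the failure of solvability. -/

section Criterion

variable {X : Type*} [MetricSpace X]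

/-- Sequential data witnessing that `f` has a closed set of restriction whose set of
discontinuities is not closed: `x` is a point of continuity, the `u n` tending to `x` are points of
discontinuity, as seen along the sequences `z n`. -/
def IsOscillationWitness (f : X → ℝ) (x : X) (u : ℕ → X) (z : ℕ → ℕ → X) : Prop :=
  (∀ n, dist (u n) x ≤ (1 / 2) ^ n) ∧ (∀ n m, dist (z n m) (u n) ≤ (1 / 2) ^ (n + m)) ∧
  (∀ n, 0 < dist (u n) x ∧ ∀ m, 0 < dist (z n m) x) ∧
  (∀ n, ∃ j : ℕ, ∀ m, (1 / 2) ^ j ≤ |f (z n m) - f (u n)|) ∧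
  (∀ j : ℕ, ∃ N, ∀ n ≥ N, |f (u n) - f x| ≤ (1 / 2) ^ j ∧ ∀ m, |f (z n m) - f x| ≤ (1 / 2) ^ j)

theorem isClosed_insert_iUnion_of_dist_le {x : X} {C : ℕ → Set X} (hC : ∀ n, IsClosed (C n))
    (h : ∀ ε > 0, ∃ N, ∀ n ≥ N, ∀ w ∈ C n, dist w x < ε) : IsClosed (insert x (⋃ n, C n)) := by
  rw [← isOpen_compl_iff, isOpen_iff_mem_nhds]
  intro w hw
  simp only [mem_compl_iff, mem_insert_iff, mem_iUnion, not_or, not_exists] at hw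
  have hpos : 0 < dist w x / 2 := half_pos (dist_pos.2 hw.1)
  obtain ⟨N, hN⟩ := h _ hpos
  have h1 : ∀ᶠ v in 𝓝 w, ∀ n ∈ Finset.range N, v ∉ C n :=
    (Finset.range N).eventually_all.2 fun n _ => (hC n).isOpen_compl.mem_nhds (hw.2 n)
  filter_upwards [h1, Metric.ball_mem_nhds w hpos] with v hv hvw
  have hvw' : dist v w < dist w x / 2 := hvw
  have htri : dist w x ≤ dist v w + dist v x := by
    rw [dist_comm v w]; exact dist_triangle _ _ _
  simp only [mem_compl_iff, mem_insert_iff, mem_iUnion, not_or, not_exists]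
  refine ⟨?_, fun n hn => ?_⟩
  · rintro rfl
    rw [dist_self] at htri
    linarith
  · by_cases hnN : n < N
    · exact hv n (Finset.mem_range.2 hnN) hn
    · have := hN n (not_lt.1 hnN) v hn
      linarith

theorem exists_half_pow_lt {ε : ℝ} (hε : 0 < ε) : ∃ N : ℕ, ∀ n ≥ N, (1 / 2 : ℝ) ^ n < ε := by
  obtain ⟨N, hN⟩ := exists_pow_lt_of_lt_one hε (by norm_num : (1 / 2 : ℝ) < 1)
  exact ⟨N, fun n hn => (pow_le_pow_of_le_one (by norm_num) (by norm_num) hn).trans_lt hN⟩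

/-- Take for `K` the witness points themselves. The compact pieces `C n` avoid `x`, so near `x` only
late pieces matter, and there `f` is close to `f x`. -/
theorem IsOscillationWitness.exists_not_isClosed {f : X → ℝ} {x : X} {u : ℕ → X} {z : ℕ → ℕ → X}
    (h : IsOscillationWitness f x u z) :
    ∃ K, IsClosed K ∧ ¬ IsClosed (discontinuitySet f K) := by
  obtain ⟨hu, hz, hne, hj, hf⟩ := h
  have hzt : ∀ n, Tendsto (z n) atTop (𝓝 (u n)) := fun n => by
    rw [Metric.tendsto_atTop]
    intro ε hε
    obtain ⟨N, hN⟩ := exists_half_pow_lt hε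
    exact ⟨N, fun m hm => (hz n m).trans_lt (hN _ (by omega))⟩
  have hut : Tendsto u atTop (𝓝 x) := by
    rw [Metric.tendsto_atTop]
    intro ε hε
    obtain ⟨N, hN⟩ := exists_half_pow_lt hε
    exact ⟨N, fun n hn => (hu n).trans_lt (hN n hn)⟩
  set C : ℕ → Set X := fun n => insert (u n) (range (z n)) with hCdef
  set K := insert x (⋃ n, C n) with hK
  have hCclosed : ∀ n, IsClosed (C n) := fun n =>
    (hzt n).isCompact_insert_range.isClosed
  have huK : ∀ n, u n ∈ K := fun n =>
    mem_insert_of_mem _ (mem_iUnion.2 ⟨n, mem_insert _ _⟩)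
  have hzK : ∀ n m, z n m ∈ K := fun n m =>
    mem_insert_of_mem _ (mem_iUnion.2 ⟨n, mem_insert_of_mem _ (mem_range_self m)⟩)
  have hKclosed : IsClosed K := by
    refine isClosed_insert_iUnion_of_dist_le hCclosed fun ε hε => ?_
    obtain ⟨N, hN⟩ := exists_half_pow_lt (half_pos hε)
    refine ⟨N, fun n hn w hw => ?_⟩
    have h1 := (hu n).trans_lt (hN n hn)
    rcases hw with rfl | ⟨m, rfl⟩
    · linarith
    · have h2 := (hz n m).trans_lt (hN (n + m) (by omega))
      linarith [dist_triangle (z n m) (u n) x]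
  have hdisc : ∀ n, u n ∈ discontinuitySet f K := fun n => by
    refine ⟨huK n, fun hc => ?_⟩
    obtain ⟨j, hj⟩ := hj n
    have h1 : Tendsto (fun m => f (z n m)) atTop (𝓝 (f (u n))) :=
      hc.tendsto.comp (tendsto_nhdsWithin_iff.2 ⟨hzt n, Eventually.of_forall (hzK n)⟩)
    obtain ⟨m, hm⟩ := ((Metric.tendsto_nhds.1 h1) ((1 / 2) ^ j) (by positivity)).exists
    rw [Real.dist_eq] at hm
    exact absurd (hj m) (not_le.2 hm)
  have hcont : x ∉ discontinuitySet f K := by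
    rintro ⟨-, hx⟩
    apply hx
    rw [Metric.continuousWithinAt_iff']
    intro ε hε
    obtain ⟨j, hjε⟩ := exists_half_pow_lt hε
    obtain ⟨N, hN⟩ := hf j
    have hxC : ∀ n, x ∉ C n := fun n hn => by
      rcases hn with h | ⟨m, h⟩
      · exact (dist_pos.1 (hne n).1) h.symm
      · exact (dist_pos.1 ((hne n).2 m)) h
    have h1 : ∀ᶠ v in 𝓝 x, ∀ n ∈ Finset.range N, v ∉ C n :=
      (Finset.range N).eventually_all.2 fun n _ => (hCclosed n).isOpen_compl.mem_nhds (hxC n)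
    filter_upwards [nhdsWithin_le_nhds h1, self_mem_nhdsWithin] with v hv hvK
    have hj' := hjε j le_rfl
    rcases hvK with rfl | hvK
    · simpa using hε
    · obtain ⟨n, hn⟩ := mem_iUnion.1 hvK
      have hnN : N ≤ n := by
        by_contra hlt
        exact hv n (Finset.mem_range.2 (not_le.1 hlt)) hn
      rw [Real.dist_eq]
      rcases hn with rfl | ⟨m, rfl⟩
      · exact (hN n hnN).1.trans_lt hj'
      · exact ((hN n hnN).2 m).trans_lt hj'
  refine ⟨K, hKclosed, fun hcl => hcont ?_⟩
  exact hcl.mem_of_tendsto hut (Eventually.of_forall hdisc)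

/-- A limit `x` of discontinuities that is not one itself is a continuity point along `K`; this
continuity controls the values at any points of `K` chosen near `x`. -/
theorem exists_isOscillationWitness {f : X → ℝ} {K : Set X} (hK : IsClosed K)
    (hf : ¬ IsClosed (discontinuitySet f K)) : ∃ x u z, IsOscillationWitness f x u z := by
  set D := discontinuitySet f K with hD
  obtain ⟨x, hx, hxD⟩ : ∃ x ∈ closure D, x ∉ D := by
    by_contra! h
    exact hf (closure_subset_iff_isClosed.1 h)
  have hxK : x ∈ K := hK.closure_subset_iff.2 (fun w hw => hw.1) hx
  have hcont : ContinuousWithinAt f K x := by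
    by_contra h
    exact hxD ⟨hxK, h⟩
  rw [Metric.continuousWithinAt_iff] at hcont
  choose δ hδ hδf using fun j : ℕ => hcont (((1 : ℝ) / 2) ^ j) (by positivity)
  have hu : ∀ n : ℕ, ∃ u ∈ D, dist u x ≤ (1 / 2) ^ n := fun n => by
    obtain ⟨u, hu, hux⟩ := Metric.mem_closure_iff.1 hx ((1 / 2) ^ n) (by positivity)
    exact ⟨u, hu, by rw [dist_comm]; exact hux.le⟩
  choose u huD hux using hu
  have hune : ∀ n, 0 < dist (u n) x := fun n => dist_pos.2 fun h => hxD (h ▸ huD n)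
  have hz : ∀ n, ∃ j : ℕ, ∀ ρ > 0, ∃ w ∈ K, dist w (u n) < ρ ∧ (1 / 2) ^ j ≤ |f w - f (u n)| := by
    intro n
    have h := (huD n).2
    rw [Metric.continuousWithinAt_iff] at h
    push Not at h
    obtain ⟨ε, hε, h⟩ := h
    obtain ⟨j, hj⟩ := exists_half_pow_lt hε
    refine ⟨j, fun ρ hρ => ?_⟩
    obtain ⟨w, hw, hwd, hwf⟩ := h ρ hρ
    exact ⟨w, hw, hwd, (hj j le_rfl).le.trans hwf⟩
  choose j hj using hz
  -- The second bound in the minimum keeps `z n m` away from `x`.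
  have hz : ∀ n m : ℕ, ∃ w ∈ K, dist w (u n) < min ((1 / 2) ^ (n + m)) (dist (u n) x) ∧
      (1 / 2) ^ (j n) ≤ |f w - f (u n)| :=
    fun n m => hj n _ (lt_min (by positivity) (hune n))
  choose z hzK hzu hzf using hz
  have hzu' : ∀ n m, dist (z n m) (u n) ≤ (1 / 2) ^ (n + m) := fun n m =>
    (hzu n m).le.trans (min_le_left _ _)
  refine ⟨x, u, z, hux, hzu', fun n => ⟨hune n, fun m => ?_⟩, fun n => ⟨j n, hzf n⟩, fun i => ?_⟩
  · have h1 := (hzu n m).trans_le (min_le_right _ _)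
    have h2 := dist_triangle_left (u n) x (z n m)
    linarith
  · obtain ⟨N, hN⟩ := exists_half_pow_lt (half_pos (hδ i))
    refine ⟨N, fun n hn => ?_⟩
    have h1 := (hux n).trans_lt (hN n hn)
    refine ⟨(hδf i (huD n).1 (by linarith [hδ i])).le, fun m => (hδf i (hzK n m) ?_).le⟩
    have h2 := (hzu' n m).trans_lt (hN (n + m) (by omega))
    linarith [dist_triangle (z n m) (u n) x]

end Criterion

/-! ### Replacing one-sided derivatives on `[0,1]` by two-sided ones. -/

section Reflection

/-- The extension of a continuous function on `[0,1]` by point reflection at both ends of its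
graph. It is differentiable at a point of `[0,1]` iff the function is so relative to `[0,1]`. -/
noncomputable def reflectExtend (y : C(unitInterval, ℝ)) (t : ℝ) : ℝ :=
  IccExtend zero_le_one y t - IccExtend zero_le_one y (-t) - IccExtend zero_le_one y (2 - t)
    + y 0 + y 1

theorem continuous_uncurry_reflectExtend : Continuous (Function.uncurry reflectExtend) := by
  have h : ∀ g : ℝ → ℝ, Continuous g → Continuous fun p : C(unitInterval, ℝ) × ℝ =>
      IccExtend zero_le_one p.1 (g p.2) := fun g hg => by
    have h2 : Continuous fun p : C(unitInterval, ℝ) × ℝ =>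
        projIcc (0 : ℝ) 1 zero_le_one (g p.2) := continuous_projIcc.comp (hg.comp continuous_snd)
    exact ContinuousEval.continuous_eval.comp (continuous_fst.prodMk h2)
  have he : ∀ x : unitInterval, Continuous fun p : C(unitInterval, ℝ) × ℝ => p.1 x := fun x =>
    (ContinuousEvalConst.continuous_eval_const x).comp continuous_fst
  exact ((((h _ continuous_id).sub (h _ continuous_neg)).sub
    (h _ (continuous_const.sub continuous_id))).add (he 0)).add (he 1)

variable (y : C(unitInterval, ℝ))

theorem continuous_reflectExtend : Continuous (reflectExtend y) :=
  continuous_uncurry_reflectExtend.comp (Continuous.prodMk_right y)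

theorem reflectExtend_of_mem {t : ℝ} (ht : t ∈ Icc (0 : ℝ) 1) :
    reflectExtend y t = IccExtend zero_le_one y t := by
  have h1 : IccExtend zero_le_one y (-t) = y 0 :=
    IccExtend_of_le_left _ _ (by linarith [ht.1])
  have h2 : IccExtend zero_le_one y (2 - t) = y 1 :=
    IccExtend_of_right_le _ _ (by linarith [ht.2])
  rw [reflectExtend, h1, h2]; ring

theorem reflectExtend_of_nonpos {t : ℝ} (ht : t ≤ 0) :
    reflectExtend y t = 2 * y 0 - IccExtend zero_le_one y (-t) := by
  have h1 : IccExtend zero_le_one y t = y 0 := IccExtend_of_le_left _ _ ht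
  have h2 : IccExtend zero_le_one y (2 - t) = y 1 :=
    IccExtend_of_right_le _ _ (by linarith)
  rw [reflectExtend, h1, h2]; ring

theorem reflectExtend_of_one_le {t : ℝ} (ht : 1 ≤ t) :
    reflectExtend y t = 2 * y 1 - IccExtend zero_le_one y (2 - t) := by
  have h1 : IccExtend zero_le_one y t = y 1 := IccExtend_of_right_le _ _ ht
  have h2 : IccExtend zero_le_one y (-t) = y 0 :=
    IccExtend_of_le_left _ _ (by linarith)
  rw [reflectExtend, h1, h2]; ring

theorem hasDerivWithinAt_const_sub_comp {f g : ℝ → ℝ} {s t : Set ℝ} {d x c a : ℝ}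
    (hf : HasDerivWithinAt f d s (a - x)) (hst : MapsTo (fun w => a - w) t s)
    (hg : ∀ w ∈ t, g w = c - f (a - w)) (hx : x ∈ t) : HasDerivWithinAt g d t x := by
  have h1 : HasDerivWithinAt (fun w => a - w) (-1) t x :=
    ((hasDerivAt_id x).const_sub a).hasDerivWithinAt
  have h2 := (hf.comp x h1 hst).const_sub c
  simp only [mul_neg, mul_one, neg_neg] at h2
  exact h2.congr hg (hg x hx)

/-- Point reflection preserves slopes, so at an end point the outer one-sided derivative exists and
agrees with the inner one. -/
theorem hasDerivAt_reflectExtend_iff {x : ℝ} (hx : x ∈ Icc (0 : ℝ) 1) {d : ℝ} :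
    HasDerivAt (reflectExtend y) d x ↔
      HasDerivWithinAt (IccExtend zero_le_one y) d (Icc 0 1) x := by
  constructor
  · intro h
    exact h.hasDerivWithinAt.congr (fun w hw => (reflectExtend_of_mem y hw).symm)
      (reflectExtend_of_mem y hx).symm
  · intro h
    have h0 : HasDerivWithinAt (reflectExtend y) d (Icc 0 1) x :=
      h.congr (fun w hw => reflectExtend_of_mem y hw) (reflectExtend_of_mem y hx)
    have h1 : HasDerivWithinAt (reflectExtend y) d (Icc (-1) 0) x := by
      by_cases hx0 : x ∈ Icc (-1 : ℝ) 0
      · obtain rfl : x = 0 := le_antisymm hx0.2 hx.1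
        refine hasDerivWithinAt_const_sub_comp (a := 0) (c := 2 * y 0)
          (f := IccExtend zero_le_one y) (s := Icc 0 1) (by simpa using h) ?_ ?_ hx0
        · intro w hw; constructor <;> linarith [hw.1, hw.2]
        · intro w hw; rw [reflectExtend_of_nonpos y hw.2, zero_sub]
      · rw [hasDerivWithinAt_iff_hasFDerivWithinAt]
        exact .of_notMem_closure (by rwa [isClosed_Icc.closure_eq])
    have h2 : HasDerivWithinAt (reflectExtend y) d (Icc 1 2) x := by
      by_cases hx0 : x ∈ Icc (1 : ℝ) 2
      · obtain rfl : x = 1 := le_antisymm hx.2 hx0.1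
        refine hasDerivWithinAt_const_sub_comp (a := 2) (c := 2 * y 1)
          (f := IccExtend zero_le_one y) (s := Icc 0 1) (by norm_num; exact h) ?_ ?_ hx0
        · intro w hw; constructor <;> linarith [hw.1, hw.2]
        · intro w hw; rw [reflectExtend_of_one_le y hw.1]
      · rw [hasDerivWithinAt_iff_hasFDerivWithinAt]
        exact .of_notMem_closure (by rwa [isClosed_Icc.closure_eq])
    refine ((h1.union h0).union h2).hasDerivAt ?_
    rw [Icc_union_Icc_eq_Icc (by norm_num) (by norm_num),
      Icc_union_Icc_eq_Icc (by norm_num) (by norm_num)]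
    exact Icc_mem_nhds (by linarith [hx.1]) (by linarith [hx.2])

theorem differentiableAt_reflectExtend_iff {x : ℝ} (hx : x ∈ Icc (0 : ℝ) 1) :
    DifferentiableAt ℝ (reflectExtend y) x ↔
      DifferentiableWithinAt ℝ (IccExtend zero_le_one y) (Icc 0 1) x := by
  constructor
  · intro h
    exact ((hasDerivAt_reflectExtend_iff y hx).1 h.hasDerivAt).differentiableWithinAt
  · intro h
    exact ((hasDerivAt_reflectExtend_iff y hx).2 h.hasDerivWithinAt).differentiableAt

theorem unitDeriv_eq_deriv_reflectExtend (x : unitInterval) :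
    unitDeriv y x = deriv (reflectExtend y) x := by
  by_cases h : DifferentiableAt ℝ (reflectExtend y) x
  · exact ((hasDerivAt_reflectExtend_iff y x.2).1 h.hasDerivAt).derivWithin
      (uniqueDiffOn_Icc zero_lt_one x x.2)
  · rw [deriv_zero_of_not_differentiableAt h, unitDeriv, derivWithin_zero_of_not_differentiableWithinAt]
    rwa [← differentiableAt_reflectExtend_iff y x.2]

theorem unitDeriv_eq_of_hasDerivWithinAt {x : unitInterval} {d : ℝ}
    (h : HasDerivWithinAt (IccExtend zero_le_one y) d (Icc 0 1) x) : unitDeriv y x = d :=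
  h.derivWithin (uniqueDiffOn_Icc zero_lt_one x x.2)

/-- The derivative is the limit of difference quotients with step `1 / (n + 1)`; the extension makes
them meaningful up to `1`. -/
theorem isBaireOne_unitDeriv
    (hy : DifferentiableOn ℝ (IccExtend zero_le_one y) (Icc 0 1)) : IsBaireOne (unitDeriv y) := by
  have hcont := continuous_reflectExtend y
  have hF : ∀ n : ℕ, Continuous fun x : unitInterval => ((1 : ℝ) / (n + 1))⁻¹ *
      (reflectExtend y ((x : ℝ) + 1 / (n + 1)) - reflectExtend y x) := fun n =>
    continuous_const.mul ((hcont.comp (continuous_subtype_val.add continuous_const)).sub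
      (hcont.comp continuous_subtype_val))
  refine ⟨fun n => ⟨_, hF n⟩, fun x => ?_⟩
  have hd := ((differentiableAt_reflectExtend_iff y x.2).2 (hy x x.2)).hasDerivAt
  rw [unitDeriv_eq_deriv_reflectExtend]
  have h1 : Tendsto (fun n : ℕ => (1 : ℝ) / (n + 1)) atTop (𝓝[≠] 0) :=
    tendsto_nhdsWithin_iff.2 ⟨tendsto_one_div_add_atTop_nhds_zero_nat,
      Eventually.of_forall fun n => (Nat.one_div_pos_of_nat (α := ℝ) (n := n)).ne'⟩
  exact (hasDerivAt_iff_tendsto_slope_zero.1 hd).comp h1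

end Reflection

/-! ### The coanalytic upper bound. -/

section Coanalytic

theorem measurable_unitDeriv [MeasurableSpace C(unitInterval, ℝ)] [BorelSpace C(unitInterval, ℝ)] :
    Measurable fun p : C(unitInterval, ℝ) × unitInterval => unitDeriv p.1 p.2 := by
  have h1 : Measurable fun p : C(unitInterval, ℝ) × ℝ => deriv (reflectExtend p.1) p.2 :=
    measurable_deriv_with_param continuous_uncurry_reflectExtend
  have h2 : Measurable fun p : C(unitInterval, ℝ) × unitInterval => (p.1, (p.2 : ℝ)) :=
    measurable_fst.prodMk (measurable_subtype_coe.comp measurable_snd)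
  have h3 : (fun p : C(unitInterval, ℝ) × unitInterval => unitDeriv p.1 p.2) =
      (fun p : C(unitInterval, ℝ) × ℝ => deriv (reflectExtend p.1) p.2) ∘
        fun p : C(unitInterval, ℝ) × unitInterval => (p.1, (p.2 : ℝ)) :=
    funext fun p => unitDeriv_eq_deriv_reflectExtend p.1 p.2
  rw [h3]
  exact h1.comp h2

theorem measurableSet_not_differentiableWithinAt
    [MeasurableSpace C(unitInterval, ℝ)] [BorelSpace C(unitInterval, ℝ)] :
    MeasurableSet {p : C(unitInterval, ℝ) × unitInterval |
      ¬ DifferentiableWithinAt ℝ (IccExtend zero_le_one p.1) (Icc 0 1) p.2} := by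
  have h := (measurableSet_of_differentiableAt_with_param ℝ
    continuous_uncurry_reflectExtend).preimage
    (measurable_fst.prodMk (measurable_subtype_coe.comp measurable_snd) :
      Measurable fun p : C(unitInterval, ℝ) × unitInterval => (p.1, (p.2 : ℝ)))
  convert! h.compl using 1
  ext p
  simp [differentiableAt_reflectExtend_iff p.1 p.2.2]

theorem MeasurableSet.analyticSet_exists {α β : Type*} [TopologicalSpace α] [PolishSpace α]
    [MeasurableSpace α] [BorelSpace α] [TopologicalSpace β] [PolishSpace β]
    [MeasurableSpace β] [BorelSpace β] {P : α × β → Prop} (h : MeasurableSet {p | P p}) :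
    MeasureTheory.AnalyticSet {a | ∃ b, P (a, b)} := by
  convert h.analyticSet.image_of_continuous continuous_fst using 1
  ext a
  simp

/-- All quantifiers in the definition of a witness range over `ℕ`. -/
theorem measurableSet_isOscillationWitness
    [MeasurableSpace C(unitInterval, ℝ)] [BorelSpace C(unitInterval, ℝ)] :
    MeasurableSet {p : C(unitInterval, ℝ) ×
      (unitInterval × (ℕ → unitInterval) × (ℕ → ℕ → unitInterval)) |
      IsOscillationWitness (unitDeriv p.1) p.2.1 p.2.2.1 p.2.2.2} := by
  set Ω := C(unitInterval, ℝ) × (unitInterval × (ℕ → unitInterval) × (ℕ → ℕ → unitInterval))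
  have hx : Measurable fun p : Ω => p.2.1 := by fun_prop
  have hu : ∀ n, Measurable fun p : Ω => p.2.2.1 n := fun n => by fun_prop
  have hz : ∀ n m, Measurable fun p : Ω => p.2.2.2 n m := fun n m => by fun_prop
  have hf : ∀ g : Ω → unitInterval, Measurable g → Measurable fun p => unitDeriv p.1 (g p) :=
    fun g hg => measurable_unitDeriv.comp (measurable_fst.prodMk hg)
  have hfx := hf _ hx
  have hfu := fun n => hf _ (hu n)
  have hfz := fun n m => hf _ (hz n m)
  have hdist : ∀ g h : Ω → unitInterval, Measurable g → Measurable h →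
      Measurable fun p => dist (g p) (h p) := fun g h hg hh => hg.dist hh
  have habs : ∀ g h : Ω → ℝ, Measurable g → Measurable h → Measurable fun p => |g p - h p| :=
    fun g h hg hh => continuous_abs.measurable.comp (hg.sub hh)
  have hle : ∀ g h : Ω → ℝ, Measurable g → Measurable h → Measurable fun p => g p ≤ h p :=
    fun g h hg hh => measurableSet_setOfPred.1 (measurableSet_le hg hh)
  have hlt : ∀ g h : Ω → ℝ, Measurable g → Measurable h → Measurable fun p => g p < h p :=
    fun g h hg hh => measurableSet_setOfPred.1 (measurableSet_lt hg hh)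
  refine measurableSet_setOfPred.2 ?_
  unfold IsOscillationWitness
  refine .and ?_ (.and ?_ (.and ?_ (.and ?_ ?_)))
  · exact .forall fun n => hle _ _ (hdist _ _ (hu n) hx) measurable_const
  · exact .forall fun n => .forall fun m => hle _ _ (hdist _ _ (hz n m) (hu n)) measurable_const
  · exact .forall fun n => .and (hlt _ _ measurable_const (hdist _ _ (hu n) hx))
      (.forall fun m => hlt _ _ measurable_const (hdist _ _ (hz n m) hx))
  · exact .forall fun n => .exists fun j => .forall fun m =>
      hle _ _ measurable_const (habs _ _ (hfz n m) (hfu n))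
  · exact .forall fun j => .exists fun N => .forall fun n => .forall fun _ =>
      .and (hle _ _ (habs _ _ (hfu n) hfx) measurable_const)
        (.forall fun m => hle _ _ (habs _ _ (hfz n m) hfx) measurable_const)

theorem isSolvableFunction_iff_forall_not_isOscillationWitness {X : Type*} [MetricSpace X]
    {f : X → ℝ} : IsSolvableFunction f ↔
      IsBaireOne f ∧ ¬ ∃ p : X × (ℕ → X) × (ℕ → ℕ → X), IsOscillationWitness f p.1 p.2.1 p.2.2 := by
  refine and_congr_right fun _ => ⟨?_, fun h K hK => ?_⟩
  · rintro h ⟨p, hp⟩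
    obtain ⟨K, hK, hf⟩ := hp.exists_not_isClosed
    exact hf (h K hK)
  · by_contra hf
    obtain ⟨x, u, z, hw⟩ := exists_isOscillationWitness hK hf
    exact h ⟨(x, u, z), hw⟩

theorem MeasureTheory.AnalyticSet.union {α : Type*} [TopologicalSpace α] {s t : Set α}
    (hs : AnalyticSet s) (ht : AnalyticSet t) : AnalyticSet (s ∪ t) := by
  rw [union_eq_iUnion]
  exact AnalyticSet.iUnion fun b => by cases b <;> assumption

/-- The complement is a union of four analytic sets, one for each way to fail; the Baire condition
drops out. -/
theorem isCoanalytic_solvableFunctions {J : Set ℝ} (hJ : MeasurableSet J) :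
    IsCoanalytic (solvableFunctions J) := by
  borelize C(unitInterval, ℝ)
  have h1 : MeasureTheory.AnalyticSet {y : C(unitInterval, ℝ) | ∃ x, ¬ y x ∈ J} :=
    MeasurableSet.analyticSet_exists (P := fun p : C(unitInterval, ℝ) × unitInterval => ¬ p.1 p.2 ∈ J)
      ((ContinuousEval.continuous_eval.measurable hJ).compl)
  have h2 := measurableSet_not_differentiableWithinAt.analyticSet_exists
  have h3 : MeasureTheory.AnalyticSet {y : C(unitInterval, ℝ) |
      ∀ M : ℕ, ∃ x, (M : ℝ) < |unitDeriv y x|} := by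
    simp only [ofPred_forall]
    exact MeasureTheory.AnalyticSet.iInter fun M => MeasurableSet.analyticSet_exists
      (P := fun p : C(unitInterval, ℝ) × unitInterval => (M : ℝ) < |unitDeriv p.1 p.2|)
      (measurableSet_lt measurable_const (continuous_abs.measurable.comp measurable_unitDeriv))
  have h4 := measurableSet_isOscillationWitness.analyticSet_exists
  have h := ((h1.union h2).union h3).union h4
  rw [IsCoanalytic]
  convert! h using 1
  ext y
  simp only [mem_compl_iff, solvableFunctions, differentiableFunctions, mem_union, mem_ofPred_eq,
    isSolvableFunction_iff_forall_not_isOscillationWitness, isBounded_iff_forall_norm_le,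
    forall_mem_range, Real.norm_eq_abs]
  have hb : (∃ C, ∀ x, |unitDeriv y x| ≤ C) ↔ ¬ ∀ M : ℕ, ∃ x, (M : ℝ) < |unitDeriv y x| := by
    push Not
    refine ⟨fun ⟨C, hC⟩ => ?_, fun ⟨M, hM⟩ => ⟨M, hM⟩⟩
    obtain ⟨M, hM⟩ := exists_nat_ge C
    exact ⟨M, fun x => (hC x).trans hM⟩
  have hd : DifferentiableOn ℝ (IccExtend zero_le_one y) (Icc 0 1) ↔
      ¬ ∃ x : unitInterval, ¬ DifferentiableWithinAt ℝ (IccExtend zero_le_one y) (Icc 0 1) x := by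
    push Not
    exact ⟨fun h x => h x x.2, fun h x hx => h ⟨x, hx⟩⟩
  have hB := isBaireOne_unitDeriv y
  rw [hb]
  rw [hd] at hB ⊢
  rw [show (∀ x, y x ∈ J) ↔ ¬ ∃ x, ¬ y x ∈ J by push Not; rfl]
  tauto

end Coanalytic

/-! ### The basic bump, with slope `1/4` around `0`. -/

section Profile

/-- A continuously differentiable function supported in `[-1,1]` which is linear near `0`. -/
noncomputable def bumpProfile (x : ℝ) : ℝ :=
  (1 / 4) * (x * (⟨1 / 2, 1, by norm_num, by norm_num⟩ : ContDiffBump (0 : ℝ)) x)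

theorem contDiff_bumpProfile : ContDiff ℝ 1 bumpProfile :=
  contDiff_const.mul (contDiff_id.mul (ContDiffBump.contDiff _))

theorem hasDerivAt_bumpProfile (x : ℝ) : HasDerivAt bumpProfile (deriv bumpProfile x) x :=
  (contDiff_bumpProfile.differentiable one_ne_zero x).hasDerivAt

theorem continuous_deriv_bumpProfile : Continuous (deriv bumpProfile) :=
  contDiff_bumpProfile.continuous_deriv le_rfl

theorem bumpProfile_of_one_lt {x : ℝ} (hx : 1 < |x|) : bumpProfile x = 0 := by
  rw [bumpProfile, ContDiffBump.zero_of_le_dist]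
  · simp
  · simpa [Real.dist_eq] using hx.le

theorem eventually_one_lt_abs {x : ℝ} (hx : 1 < |x|) : ∀ᶠ w in 𝓝 x, 1 < |w| :=
  continuous_abs.continuousAt.eventually_const_lt hx

theorem deriv_bumpProfile_of_one_lt {x : ℝ} (hx : 1 < |x|) : deriv bumpProfile x = 0 := by
  have h : bumpProfile =ᶠ[𝓝 x] fun _ => 0 := by
    filter_upwards [eventually_one_lt_abs hx] with w hw using bumpProfile_of_one_lt hw
  rw [h.deriv_eq, deriv_const]

theorem abs_bumpProfile_le (x : ℝ) : |bumpProfile x| ≤ 1 / 4 := by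
  by_cases hx : 1 < |x|
  · rw [bumpProfile_of_one_lt hx]; norm_num
  · rw [bumpProfile, abs_mul, abs_mul, abs_of_nonneg (ContDiffBump.nonneg _)]
    have h1 := ContDiffBump.le_one (⟨1 / 2, 1, by norm_num, by norm_num⟩ : ContDiffBump (0 : ℝ))
      (x := x)
    have h2 := mul_le_one₀ (not_lt.1 hx) (ContDiffBump.nonneg' _ x) h1
    rw [abs_of_nonneg (by norm_num : (0 : ℝ) ≤ 1 / 4)]
    linarith

theorem deriv_bumpProfile_of_lt {x : ℝ} (hx : |x| < 1 / 2) : deriv bumpProfile x = 1 / 4 := by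
  have h : bumpProfile =ᶠ[𝓝 x] fun w => (1 / 4) * w := by
    filter_upwards [continuous_abs.continuousAt.eventually_lt_const hx] with w hw
    rw [bumpProfile, ContDiffBump.one_of_mem_closedBall, mul_one]
    simpa [Real.dist_eq] using hw.le
  rw [h.deriv_eq, deriv_const_mul_id]

theorem exists_abs_deriv_bumpProfile_le : ∃ C, ∀ x, |deriv bumpProfile x| ≤ C := by
  obtain ⟨C, hC⟩ := (isCompact_Icc (a := (-1 : ℝ)) (b := 1)).exists_bound_of_continuousOn
    continuous_deriv_bumpProfile.continuousOn
  refine ⟨C, fun x => ?_⟩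
  by_cases hx : 1 < |x|
  · rw [deriv_bumpProfile_of_one_lt hx, abs_zero]
    exact (norm_nonneg _).trans (hC 0 (by norm_num))
  · exact hC x (abs_le.1 (not_lt.1 hx))

end Profile

/-! ### Disjoint cells shrinking to `0`, and gluing rescaled functions into them. -/

section Cells

/-- The centre of the `n`-th cell, the cells being disjoint intervals converging to `0`. -/
noncomputable def cellCenter (n : ℕ) : ℝ := (1 / 2) ^ (n + 2)

/-- The radius of the `n`-th cell. -/
noncomputable def cellRadius (n : ℕ) : ℝ := cellCenter n ^ 2 / 8

/-- The affine coordinate mapping the `n`-th cell to `[-1,1]`. -/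
noncomputable def cellCoord (n : ℕ) (x : ℝ) : ℝ := (x - cellCenter n) / cellRadius n

theorem cellCenter_pos (n : ℕ) : 0 < cellCenter n := by unfold cellCenter; positivity

theorem cellCenter_le (n : ℕ) : cellCenter n ≤ 1 / 4 := by
  have := pow_le_pow_of_le_one (by norm_num : (0 : ℝ) ≤ 1 / 2) (by norm_num)
    (by omega : 2 ≤ n + 2)
  unfold cellCenter; linarith

theorem cellCenter_le_half {m n : ℕ} (h : m < n) : cellCenter n ≤ cellCenter m / 2 := by
  have := pow_le_pow_of_le_one (by norm_num : (0 : ℝ) ≤ 1 / 2) (by norm_num)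
    (by omega : m + 2 + 1 ≤ n + 2)
  unfold cellCenter; rw [pow_succ _ (m + 2)] at this; linarith

theorem cellRadius_pos (n : ℕ) : 0 < cellRadius n := by
  have := cellCenter_pos n
  unfold cellRadius; positivity

theorem cellRadius_le_center (n : ℕ) : cellRadius n ≤ cellCenter n / 32 := by
  have h1 := cellCenter_pos n
  have h2 := cellCenter_le n
  unfold cellRadius; nlinarith

theorem cellRadius_le (n : ℕ) : cellRadius n ≤ 1 / 128 := by
  linarith [cellRadius_le_center n, cellCenter_le n]

theorem cellCenter_add_sub (n : ℕ) (x : ℝ) :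
    cellCenter n + cellRadius n * cellCoord n x = x := by
  have := (cellRadius_pos n).ne'
  unfold cellCoord; field_simp; ring

theorem cellCoord_center_add (n : ℕ) (t : ℝ) :
    cellCoord n (cellCenter n + cellRadius n * t) = t := by
  have := (cellRadius_pos n).ne'
  unfold cellCoord; field_simp; ring

theorem continuous_cellCoord (n : ℕ) : Continuous (cellCoord n) := by
  unfold cellCoord; fun_prop

theorem hasDerivAt_cellCoord (n : ℕ) (x : ℝ) :
    HasDerivAt (cellCoord n) (cellRadius n)⁻¹ x := by
  have := ((hasDerivAt_id x).sub_const (cellCenter n)).div_const (cellRadius n)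
  simpa [cellCoord, one_div] using! this

theorem mem_Icc_of_abs_cellCoord_le {n : ℕ} {x : ℝ} (h : |cellCoord n x| ≤ 1) :
    x ∈ Icc (31 / 32 * cellCenter n) (33 / 32 * cellCenter n) := by
  have h1 := cellCenter_add_sub n x
  have h2 := abs_le.1 h
  have h3 := cellRadius_pos n
  have h4 := cellRadius_le_center n
  constructor <;> nlinarith

/-- Distinct centres differ by a factor of at least `2`, whereas a cell deviates from its centre by
at most one part in `32`. -/
theorem one_lt_abs_cellCoord_of_ratio {m n : ℕ} (hmn : m ≠ n) {x w : ℝ} (h : |x - w| ≤ |x| / 20)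
    (hx : |cellCoord n x| ≤ 1) : 1 < |cellCoord m w| := by
  by_contra! hw
  have h1 := mem_Icc_of_abs_cellCoord_le hx
  have h2 := mem_Icc_of_abs_cellCoord_le hw
  have h3 := cellCenter_pos n
  have h4 := cellCenter_pos m
  rw [abs_of_nonneg (by linarith [h1.1] : 0 ≤ x), abs_le] at h
  rcases lt_or_gt_of_ne hmn with hlt | hlt
  · have := cellCenter_le_half hlt
    linarith [h1.1, h1.2, h2.1, h2.2, h.1, h.2]
  · have := cellCenter_le_half hlt
    linarith [h1.1, h1.2, h2.1, h2.2, h.1, h.2]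

theorem one_lt_abs_cellCoord {m n : ℕ} (hmn : m ≠ n) {x : ℝ} (hx : |cellCoord n x| ≤ 1) :
    1 < |cellCoord m x| :=
  one_lt_abs_cellCoord_of_ratio hmn (by rw [sub_self, abs_zero]; positivity) hx

theorem one_lt_abs_cellCoord_of_nonpos (n : ℕ) {x : ℝ} (hx : x ≤ 0) : 1 < |cellCoord n x| := by
  by_contra! h
  linarith [(mem_Icc_of_abs_cellCoord_le h).1, cellCenter_pos n]

theorem exists_forall_ne_one_lt_abs_cellCoord (x : ℝ) :
    ∃ n, ∀ m ≠ n, 1 < |cellCoord m x| := by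
  by_cases h : ∃ n, |cellCoord n x| ≤ 1
  · obtain ⟨n, hn⟩ := h
    exact ⟨n, fun m hm => one_lt_abs_cellCoord hm hn⟩
  · push Not at h
    exact ⟨0, fun m _ => h m⟩

theorem exists_eventually_forall_ne_one_lt_abs_cellCoord {x : ℝ} (hx : x ≠ 0) :
    ∃ n, ∀ᶠ w in 𝓝 x, ∀ m ≠ n, 1 < |cellCoord m w| := by
  have hpos : 0 < |x| / 50 := by positivity
  by_cases h : ∃ v, |v - x| < |x| / 50 ∧ ∃ n, |cellCoord n v| ≤ 1
  · obtain ⟨v, hv, n, hn⟩ := h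
    refine ⟨n, ?_⟩
    filter_upwards [Metric.ball_mem_nhds x hpos] with w hw m hm
    rw [Metric.mem_ball, Real.dist_eq] at hw
    refine one_lt_abs_cellCoord_of_ratio hm ?_ hn
    have h1 := abs_sub_le v x w
    have h2 := abs_sub_abs_le_abs_sub x v
    rw [abs_sub_comm x w] at h1
    rw [abs_sub_comm x v] at h2
    linarith
  · push Not at h
    refine ⟨0, ?_⟩
    filter_upwards [Metric.ball_mem_nhds x hpos] with w hw m _
    exact h w hw m

theorem cellRadius_le_sq {n : ℕ} {x : ℝ} (h : |cellCoord n x| ≤ 1) : cellRadius n ≤ x ^ 2 := by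
  have h1 := (mem_Icc_of_abs_cellCoord_le h).1
  have h2 := cellCenter_pos n
  unfold cellRadius
  nlinarith

theorem tsum_cell_eq {x : ℝ} {n : ℕ} (hn : ∀ m ≠ n, 1 < |cellCoord m x|) {w : ℕ → ℝ}
    {g : ℕ → ℝ → ℝ} (hg : ∀ m t, 1 < |t| → g m t = 0) :
    ∑' m, w m * g m (cellCoord m x) = w n * g n (cellCoord n x) :=
  tsum_eq_single n fun m hm => by rw [hg m _ (hn m hm), mul_zero]

/-- Copies of functions supported in `[-1,1]`, rescaled to the cells, form a differentiable
function. -/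
theorem hasDerivAt_tsum_cell {g g' : ℕ → ℝ → ℝ} {M : ℝ} (hg : ∀ m t, 1 < |t| → g m t = 0)
    (hg' : ∀ m t, 1 < |t| → g' m t = 0) (hgM : ∀ m t, |g m t| ≤ M)
    (hd : ∀ m t, HasDerivAt (g m) (g' m t) t) (x : ℝ) :
    HasDerivAt (fun x => ∑' m, cellRadius m * g m (cellCoord m x))
      (∑' m, 1 * g' m (cellCoord m x)) x := by
  by_cases hx : x = 0
  · subst hx
    have hout : ∀ n, 1 < |cellCoord n 0| := fun n => one_lt_abs_cellCoord_of_nonpos n le_rfl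
    rw [tsum_cell_eq (n := 0) (fun m _ => hout m) hg', hg' _ _ (hout 0), mul_zero]
    rw [hasDerivAt_iff_isLittleO_nhds_zero]
    -- Radii quadratic in the centres make the sum `O(h ^ 2)`, hence of derivative `0` at the
    -- accumulation point of the cells.
    have hb : ∀ h : ℝ, |∑' m, cellRadius m * g m (cellCoord m h)| ≤ M * h ^ 2 := fun h => by
      have hM : 0 ≤ M := (abs_nonneg _).trans (hgM 0 0)
      obtain ⟨n, hn⟩ := exists_forall_ne_one_lt_abs_cellCoord h
      rw [tsum_cell_eq hn hg]
      by_cases hnh : |cellCoord n h| ≤ 1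
      · rw [abs_mul, abs_of_pos (cellRadius_pos n), mul_comm]
        exact mul_le_mul (hgM _ _) (cellRadius_le_sq hnh) (cellRadius_pos n).le hM
      · rw [hg _ _ (not_le.1 hnh), mul_zero, abs_zero]; positivity
    have h0 : ∑' m, cellRadius m * g m (cellCoord m 0) = 0 := by simpa using hb 0
    have hO : (fun h : ℝ => ∑' m, cellRadius m * g m (cellCoord m h)) =O[𝓝 0] fun h => h ^ 2 :=
      Asymptotics.IsBigO.of_bound M (Eventually.of_forall fun h => by
        simpa [abs_of_nonneg (sq_nonneg h)] using hb h)
    have ho : (fun h : ℝ => h ^ 2) =o[𝓝 0] fun h => h :=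
      Asymptotics.isLittleO_pow_id one_lt_two
    simpa [h0] using hO.trans_isLittleO ho
  · obtain ⟨n, hn⟩ := exists_eventually_forall_ne_one_lt_abs_cellCoord hx
    rw [tsum_cell_eq hn.self_of_nhds hg']
    have h1 := ((hd n (cellCoord n x)).comp x (hasDerivAt_cellCoord n x)).const_mul (cellRadius n)
    have h2 : cellRadius n * (g' n (cellCoord n x) * (cellRadius n)⁻¹) =
        1 * g' n (cellCoord n x) := by
      have := (cellRadius_pos n).ne'
      field_simp
    rw [h2] at h1
    refine h1.congr_of_eventuallyEq ?_
    filter_upwards [hn] with w hw using tsum_cell_eq hw hg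

end Cells

/-! ### The self-similar function of a tree and its slope. -/

section Layers

/-- The `n`-th subtree of a set of finite sequences. Each immediate subtree occurs for infinitely
many `n`. -/
def subtree (T : Set (List ℕ)) (n : ℕ) : Set (List ℕ) := {s | (Nat.unpair n).1 :: s ∈ T}

open Classical in
/-- Copies of `h`, weighted by `w`, in the cells of depth `k` that belong to the tree `T`. -/
noncomputable def layer (h : ℝ → ℝ) (w : ℕ → ℝ) : ℕ → Set (List ℕ) → ℝ → ℝ
  | 0, T, x => if [] ∈ T then h x else 0
  | k + 1, T, x =>
    if [] ∈ T then (1 / 2) * ∑' n, w n * layer h w k (subtree T n) (cellCoord n x) else 0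

theorem one_lt_abs_cellCoord_of_one_lt (n : ℕ) {x : ℝ} (hx : 1 < |x|) : 1 < |cellCoord n x| := by
  by_contra! h
  have h1 := mem_Icc_of_abs_cellCoord_le h
  have h2 := cellCenter_pos n
  have h3 := cellCenter_le n
  rw [abs_of_nonneg (by linarith [h1.1])] at hx
  linarith [h1.2]

variable {h : ℝ → ℝ} {w : ℕ → ℝ}

theorem layer_of_nil_notMem (k : ℕ) {T : Set (List ℕ)} (hT : [] ∉ T) (x : ℝ) :
    layer h w k T x = 0 := by
  cases k <;> simp [layer, hT]

theorem layer_of_one_lt (hh : ∀ x, 1 < |x| → h x = 0) (k : ℕ) (T : Set (List ℕ)) {x : ℝ}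
    (hx : 1 < |x|) : layer h w k T x = 0 := by
  induction k generalizing T x with
  | zero => simp [layer, hh x hx]
  | succ k ih =>
    have : ∀ n, layer h w k (subtree T n) (cellCoord n x) = 0 := fun n =>
      ih _ (one_lt_abs_cellCoord_of_one_lt n hx)
    simp [layer, this]

theorem layer_succ (hh : ∀ x, 1 < |x| → h x = 0) (k : ℕ) {T : Set (List ℕ)} (hT : [] ∈ T)
    {x : ℝ} {n : ℕ} (hn : ∀ m ≠ n, 1 < |cellCoord m x|) :
    layer h w (k + 1) T x = (1 / 2) * (w n * layer h w k (subtree T n) (cellCoord n x)) := by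
  rw [layer, if_pos hT, tsum_cell_eq (g := fun n => layer h w k (subtree T n)) hn
    fun m t ht => layer_of_one_lt hh k _ ht]

/-- At each point at most one cell contributes, and each level brings a factor `1 / 2`. The
resulting geometric bound permits termwise differentiation of the sum over `k`. -/
theorem abs_layer_le (hh : ∀ x, 1 < |x| → h x = 0) {M : ℝ} (hM : ∀ x, |h x| ≤ M)
    (hw : ∀ n, |w n| ≤ 1) (k : ℕ) (T : Set (List ℕ)) (x : ℝ) :
    |layer h w k T x| ≤ M * (1 / 2) ^ k := by
  have hM0 : 0 ≤ M := (abs_nonneg _).trans (hM 0)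
  induction k generalizing T x with
  | zero =>
    by_cases hT : [] ∈ T <;> simp [layer, hT, hM x, hM0]
  | succ k ih =>
    by_cases hT : [] ∈ T
    · obtain ⟨n, hn⟩ := exists_forall_ne_one_lt_abs_cellCoord x
      rw [layer_succ hh k hT hn, abs_mul, abs_mul, pow_succ, abs_of_pos (by norm_num : (0:ℝ) < 1 / 2)]
      have h1 := mul_le_mul (hw n) (ih (subtree T n) (cellCoord n x)) (abs_nonneg _) zero_le_one
      linarith
    · rw [layer_of_nil_notMem _ hT, abs_zero]; positivity

theorem summable_layer (hh : ∀ x, 1 < |x| → h x = 0) {M : ℝ} (hM : ∀ x, |h x| ≤ M)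
    (hw : ∀ n, |w n| ≤ 1) (T : Set (List ℕ)) (x : ℝ) : Summable fun k => layer h w k T x :=
  .of_norm_bounded (summable_geometric_two.mul_left M) fun k => abs_layer_le hh hM hw k T x

theorem abs_tsum_layer_le (hh : ∀ x, 1 < |x| → h x = 0) {M : ℝ} (hM : ∀ x, |h x| ≤ M)
    (hw : ∀ n, |w n| ≤ 1) (T : Set (List ℕ)) (x : ℝ) : |∑' k, layer h w k T x| ≤ M * 2 := by
  rw [← Real.norm_eq_abs]
  exact tsum_of_norm_bounded (hasSum_geometric_two.mul_left M) fun k => abs_layer_le hh hM hw k T x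

theorem abs_cellRadius_le_one (n : ℕ) : |cellRadius n| ≤ 1 := by
  rw [abs_of_pos (cellRadius_pos n)]; linarith [cellRadius_le n]

/-- The function on the line attached to a tree. -/
noncomputable def treePotential (T : Set (List ℕ)) (x : ℝ) : ℝ :=
  ∑' k, layer bumpProfile cellRadius k T x

/-- The derivative of `treePotential T`. -/
noncomputable def treeSlope (T : Set (List ℕ)) (x : ℝ) : ℝ :=
  ∑' k, layer (deriv bumpProfile) (fun _ => 1) k T x

/-- The weight `cellRadius` cancels the slope of `cellCoord`, which is why the slope layers carry
weight `1` and do not shrink with the cells. -/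
theorem hasDerivAt_layer (k : ℕ) (T : Set (List ℕ)) (x : ℝ) :
    HasDerivAt (layer bumpProfile cellRadius k T)
      (layer (deriv bumpProfile) (fun _ => 1) k T x) x := by
  induction k generalizing T x with
  | zero =>
    by_cases hT : [] ∈ T
    · simpa [layer, hT] using! hasDerivAt_bumpProfile x
    · simpa [layer, hT] using! hasDerivAt_const x (0 : ℝ)
  | succ k ih =>
    by_cases hT : [] ∈ T
    · have h1 := (hasDerivAt_tsum_cell
        (g := fun n => layer bumpProfile cellRadius k (subtree T n))
        (g' := fun n => layer (deriv bumpProfile) (fun _ => 1) k (subtree T n))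
        (fun m t => layer_of_one_lt (fun _ => bumpProfile_of_one_lt) k _)
        (fun m t => layer_of_one_lt (fun _ => deriv_bumpProfile_of_one_lt) k _)
        (fun m t => abs_layer_le (fun _ => bumpProfile_of_one_lt) abs_bumpProfile_le
          abs_cellRadius_le_one k _ t)
        (fun m t => ih _ t) x).const_mul (1 / 2)
      have h2 : layer bumpProfile cellRadius (k + 1) T = fun x => (1 / 2) *
          ∑' n, cellRadius n * layer bumpProfile cellRadius k (subtree T n) (cellCoord n x) :=
        funext fun x => by rw [layer, if_pos hT]
      rw [h2, layer, if_pos hT]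
      exact h1
    · have h2 : layer bumpProfile cellRadius (k + 1) T = fun _ => 0 :=
        funext fun x => layer_of_nil_notMem _ hT x
      rw [h2, layer_of_nil_notMem _ hT]
      exact hasDerivAt_const x 0

theorem hasDerivAt_treePotential (T : Set (List ℕ)) (x : ℝ) :
    HasDerivAt (treePotential T) (treeSlope T x) x := by
  obtain ⟨C, hC⟩ := exists_abs_deriv_bumpProfile_le
  exact hasDerivAt_tsum (summable_geometric_two.mul_left C)
    (fun k x => hasDerivAt_layer k T x)
    (fun k x => abs_layer_le (fun _ => deriv_bumpProfile_of_one_lt) hC (fun _ => by simp) k T x)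
    (summable_layer (fun _ => bumpProfile_of_one_lt) abs_bumpProfile_le
      abs_cellRadius_le_one T 0) x

theorem abs_treePotential_le (T : Set (List ℕ)) (x : ℝ) : |treePotential T x| ≤ 1 / 2 :=
  (abs_tsum_layer_le (fun _ => bumpProfile_of_one_lt) abs_bumpProfile_le
    abs_cellRadius_le_one T x).trans (by norm_num)

theorem exists_abs_treeSlope_le : ∃ C, ∀ T x, |treeSlope T x| ≤ C := by
  obtain ⟨C, hC⟩ := exists_abs_deriv_bumpProfile_le
  exact ⟨C * 2, fun T x => abs_tsum_layer_le (fun _ => deriv_bumpProfile_of_one_lt) hC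
    (fun _ => by simp) T x⟩

theorem treeSlope_of_nil_notMem {T : Set (List ℕ)} (hT : [] ∉ T) (x : ℝ) : treeSlope T x = 0 := by
  simp [treeSlope, layer_of_nil_notMem _ hT]

theorem treeSlope_of_one_lt (T : Set (List ℕ)) {x : ℝ} (hx : 1 < |x|) : treeSlope T x = 0 := by
  simp [treeSlope, layer_of_one_lt (fun _ => deriv_bumpProfile_of_one_lt) _ T hx]

/-- This self-similarity carries both the induction on subtrees and the computation along branches.
-/
theorem treeSlope_eq {T : Set (List ℕ)} (hT : [] ∈ T) {x : ℝ} {n : ℕ}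
    (hn : ∀ m ≠ n, 1 < |cellCoord m x|) :
    treeSlope T x = deriv bumpProfile x + (1 / 2) * treeSlope (subtree T n) (cellCoord n x) := by
  obtain ⟨C, hC⟩ := exists_abs_deriv_bumpProfile_le
  rw [treeSlope, (summable_layer (fun _ => deriv_bumpProfile_of_one_lt) hC
    (fun _ => by simp) T x).tsum_eq_zero_add]
  congr 1
  · simp [layer, hT]
  · simp_rw [layer_succ (fun _ => deriv_bumpProfile_of_one_lt) _ hT hn, one_mul, tsum_mul_left]
    rfl

theorem treeSlope_zero {T : Set (List ℕ)} (hT : [] ∈ T) : treeSlope T 0 = 1 / 4 := by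
  have hout : ∀ n, 1 < |cellCoord n 0| := fun n => one_lt_abs_cellCoord_of_nonpos n le_rfl
  rw [treeSlope_eq hT (n := 0) fun m _ => hout m, treeSlope_of_one_lt _ (hout 0),
    deriv_bumpProfile_of_lt (by simp)]
  norm_num

end Layers

/-! ### Trees without branches have solvable slopes. -/

section WellFounded

/-- Solvability, apart from the Baire class, of the slope of a tree, together with a lower bound at
its discontinuities. -/
def HasSolvableSlope (T : Set (List ℕ)) : Prop :=
  (∀ x, ¬ ContinuousAt (treeSlope T) x → 1 / 4 ≤ treeSlope T x) ∧
  ∀ K : Set ℝ, IsClosed K → IsClosed (discontinuitySet (treeSlope T) K)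

theorem hasSolvableSlope_of_nil_notMem {T : Set (List ℕ)} (hT : [] ∉ T) : HasSolvableSlope T := by
  have h : treeSlope T = fun _ => 0 := funext fun x => treeSlope_of_nil_notMem hT x
  rw [HasSolvableSlope, h]
  refine ⟨fun x hx => (hx continuousAt_const).elim, fun K _ => ?_⟩
  have : discontinuitySet (fun _ : ℝ => (0 : ℝ)) K = ∅ :=
    eq_empty_of_forall_notMem fun x hx => hx.2 continuousWithinAt_const
  rw [this]; exact isClosed_empty

/-- The coordinate of a cell as a homeomorphism. -/
noncomputable def cellHomeomorph (n : ℕ) : ℝ ≃ₜ ℝ where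
  toFun := cellCoord n
  invFun t := cellCenter n + cellRadius n * t
  left_inv := cellCenter_add_sub n
  right_inv := cellCoord_center_add n
  continuous_toFun := continuous_cellCoord n
  continuous_invFun := by fun_prop

theorem Topology.IsEmbedding.continuousWithinAt_comp_iff {X Y Z : Type*} [TopologicalSpace X]
    [TopologicalSpace Y] [TopologicalSpace Z] {e : X → Y} (he : IsEmbedding e) {f : Y → Z}
    {K : Set X} {x : X} :
    ContinuousWithinAt (fun w => f (e w)) K x ↔ ContinuousWithinAt f (e '' K) (e x) := by
  rw [ContinuousWithinAt, ContinuousWithinAt, ← he.map_nhdsWithin_eq, tendsto_map'_iff]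
  rfl

theorem continuousWithinAt_comp_cellCoord_iff {f : ℝ → ℝ} {n : ℕ} {K : Set ℝ} {x : ℝ} :
    ContinuousWithinAt (fun w => f (cellCoord n w)) K x ↔
      ContinuousWithinAt f (cellCoord n '' K) (cellCoord n x) :=
  (cellHomeomorph n).isEmbedding.continuousWithinAt_comp_iff

/-- When a single cell matters near `x`, the slope is a continuous function plus half a rescaled
copy of the subtree's slope. -/
theorem continuousWithinAt_treeSlope_iff {T : Set (List ℕ)} (hT : [] ∈ T) {x : ℝ} {n : ℕ}
    (hn : ∀ᶠ w in 𝓝 x, ∀ m ≠ n, 1 < |cellCoord m w|) (K : Set ℝ) :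
    ContinuousWithinAt (treeSlope T) K x ↔
      ContinuousWithinAt (treeSlope (subtree T n)) (cellCoord n '' K) (cellCoord n x) := by
  have h1 : treeSlope T =ᶠ[𝓝 x] fun w =>
      deriv bumpProfile w + (1 / 2) * treeSlope (subtree T n) (cellCoord n w) := by
    filter_upwards [hn] with w hw using treeSlope_eq hT hw
  have hb := continuous_deriv_bumpProfile.continuousWithinAt (s := K) (x := x)
  rw [← continuousWithinAt_comp_cellCoord_iff,
    (h1.filter_mono nhdsWithin_le_nhds).congr_continuousWithinAt h1.self_of_nhds]
  refine ⟨fun h => ?_, fun h => hb.add (h.const_mul _)⟩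
  have := (h.sub hb).const_mul 2
  refine this.congr (fun w _ => ?_) ?_ <;> simp only [Pi.sub_apply] <;> ring

/-- The bound is `1/4 + (1/2) * (1/4)`. The subtree's slope is at least `1/4` at its
discontinuities, which forces `x` into a cell, where the bump has slope `1/4`. -/
theorem le_treeSlope_of_not_continuousAt {T : Set (List ℕ)} (hT : [] ∈ T)
    (h : ∀ n, HasSolvableSlope (subtree T n)) {x : ℝ} (hx0 : x ≠ 0)
    (hx : ¬ ContinuousAt (treeSlope T) x) : 3 / 8 ≤ treeSlope T x := by
  obtain ⟨n, hn⟩ := exists_eventually_forall_ne_one_lt_abs_cellCoord hx0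
  rw [← continuousWithinAt_univ, continuousWithinAt_treeSlope_iff hT hn, image_univ,
    show range (cellCoord n) = univ from (cellHomeomorph n).surjective.range_eq,
    continuousWithinAt_univ] at hx
  have h1 := (h n).1 _ hx
  have hle : |cellCoord n x| ≤ 1 := by
    by_contra! hlt
    rw [treeSlope_of_one_lt _ hlt] at h1
    norm_num at h1
  have h2 := mem_Icc_of_abs_cellCoord_le hle
  have h3 := cellCenter_pos n
  have h4 := cellCenter_le n
  rw [treeSlope_eq hT hn.self_of_nhds, deriv_bumpProfile_of_lt]
  · linarith
  · rw [abs_of_nonneg (by linarith [h2.1])]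
    linarith [h2.2]

/-- Away from `0` the claim is local to one cell. If the restriction to `K` is continuous at `0`,
nearby slopes on `K` stay below `3/8`, so discontinuities cannot accumulate there. The lower bound
in `HasSolvableSlope` serves to keep this gap at every level. -/
theorem hasSolvableSlope_of_subtree {T : Set (List ℕ)} (hT : [] ∈ T)
    (h : ∀ n, HasSolvableSlope (subtree T n)) : HasSolvableSlope T := by
  refine ⟨fun x hx => ?_, fun K hK => ?_⟩
  · by_cases hx0 : x = 0
    · rw [hx0, treeSlope_zero hT]
    · linarith [le_treeSlope_of_not_continuousAt hT h hx0 hx]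
  · rw [← closure_subset_iff_isClosed]
    intro x hx
    have hxK : x ∈ K := hK.closure_subset_iff.2 (fun w hw => hw.1) hx
    refine ⟨hxK, fun hc => ?_⟩
    by_cases hx0 : x = 0
    · subst hx0
      have h1 : ∀ᶠ w in 𝓝[K] 0, treeSlope T w < 3 / 8 := by
        refine hc.eventually_lt_const ?_
        rw [treeSlope_zero hT]; norm_num
      rw [eventually_nhdsWithin_iff] at h1
      obtain ⟨w, hw, hwD⟩ := (mem_closure_iff_frequently.1 hx).and_eventually h1 |>.exists
      have hw0 : w ≠ 0 := by
        rintro rfl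
        exact hw.2 hc
      have := le_treeSlope_of_not_continuousAt hT h hw0 fun hcw => hw.2 hcw.continuousWithinAt
      linarith [hwD hw.1]
    · obtain ⟨n, hn⟩ := exists_eventually_forall_ne_one_lt_abs_cellCoord hx0
      have hK' : IsClosed (cellCoord n '' K) := (cellHomeomorph n).isClosedMap K hK
      have hcl := (h n).2 _ hK'
      rw [continuousWithinAt_treeSlope_iff hT hn] at hc
      have h1 : ∀ᶠ w in 𝓝 x, cellCoord n w ∉
          discontinuitySet (treeSlope (subtree T n)) (cellCoord n '' K) :=
        (continuous_cellCoord n).continuousAt.eventually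
          (hcl.isOpen_compl.mem_nhds fun hmem => hmem.2 hc)
      obtain ⟨w, hw, hwn, hwD⟩ := (mem_closure_iff_frequently.1 hx).and_eventually
        (hn.eventually_nhds.and h1) |>.exists
      refine hwD ⟨mem_image_of_mem _ hw.1, ?_⟩
      rw [← continuousWithinAt_treeSlope_iff hT hwn]
      exact hw.2

/-- The sequence of labels `β 0, …, β (k - 1)`. -/
def initialSegment (β : ℕ → ℕ) (k : ℕ) : List ℕ := (List.range k).map β

theorem initialSegment_succ (β : ℕ → ℕ) (k : ℕ) :
    initialSegment β (k + 1) = β 0 :: initialSegment (fun i => β (i + 1)) k := by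
  simp [initialSegment, List.range_succ_eq_map, Function.comp_def]

/-- Failure passes to some subtree; iterating the choice spells out a branch. This replaces
induction on the rank, and `T` need not be closed under prefixes. -/
theorem exists_branch_of_not_hasSolvableSlope {T : Set (List ℕ)} (hT : ¬ HasSolvableSlope T) :
    ∃ β : ℕ → ℕ, ∀ k, initialSegment β k ∈ T := by
  have hstep : ∀ S : {S : Set (List ℕ) // ¬ HasSolvableSlope S}, [] ∈ S.1 ∧
      ∃ n, ¬ HasSolvableSlope (subtree S.1 n) := fun S => by
    have h1 : [] ∈ S.1 := by
      by_contra h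
      exact S.2 (hasSolvableSlope_of_nil_notMem h)
    refine ⟨h1, ?_⟩
    by_contra! h
    exact S.2 (hasSolvableSlope_of_subtree h1 h)
  choose hnil ν hν using hstep
  let next : {S : Set (List ℕ) // ¬ HasSolvableSlope S} → {S : Set (List ℕ) // ¬ HasSolvableSlope S} :=
    fun S => ⟨subtree S.1 (ν S), hν S⟩
  let β : {S : Set (List ℕ) // ¬ HasSolvableSlope S} → ℕ → ℕ := fun S i =>
    (Nat.unpair (ν (next^[i] S))).1
  have hβ : ∀ k S, initialSegment (β S) k ∈ S.1 := by
    intro k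
    induction k with
    | zero => exact hnil
    | succ k ih =>
      intro S
      rw [initialSegment_succ]
      exact ih (next S)
  exact ⟨β ⟨T, hT⟩, fun k => hβ k ⟨T, hT⟩⟩

end WellFounded

/-! ### A branch produces an oscillation witness. -/

section Branches

/-- The radius of the cell reached after `k` steps along `ν`. -/
noncomputable def nestedRadius (ν : ℕ → ℕ) (k : ℕ) : ℝ := ∏ i ∈ Finset.range k, cellRadius (ν i)

/-- The centre of the cell reached after `k` steps along `ν`. -/
noncomputable def nestedCenter (ν : ℕ → ℕ) (k : ℕ) : ℝ :=
  ∑ j ∈ Finset.range k, nestedRadius ν j * cellCenter (ν j)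

/-- The limit of the nested cells along `ν`. -/
noncomputable def nestedLimit (ν : ℕ → ℕ) : ℝ := ∑' j, nestedRadius ν j * cellCenter (ν j)

theorem nestedRadius_nonneg (ν : ℕ → ℕ) (k : ℕ) : 0 ≤ nestedRadius ν k :=
  Finset.prod_nonneg fun _ _ => (cellRadius_pos _).le

theorem nestedRadius_le (ν : ℕ → ℕ) (k : ℕ) : nestedRadius ν k ≤ (1 / 2) ^ k := by
  have h2 : nestedRadius ν k ≤ ∏ i ∈ Finset.range k, (1 / 2 : ℝ) :=
    Finset.prod_le_prod (fun _ _ => (cellRadius_pos _).le)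
      fun i _ => (cellRadius_le (ν i)).trans (by norm_num)
  simpa using h2

theorem nestedRadius_succ' (ν : ℕ → ℕ) (k : ℕ) :
    nestedRadius ν (k + 1) = cellRadius (ν 0) * nestedRadius (fun i => ν (i + 1)) k := by
  rw [nestedRadius, Finset.prod_range_succ', mul_comm, nestedRadius]

theorem nestedCenter_succ (ν : ℕ → ℕ) (k : ℕ) :
    nestedCenter ν (k + 1) = nestedCenter ν k + nestedRadius ν k * cellCenter (ν k) :=
  Finset.sum_range_succ _ _

theorem nestedCenter_succ' (ν : ℕ → ℕ) (k : ℕ) :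
    nestedCenter ν (k + 1) =
      cellCenter (ν 0) + cellRadius (ν 0) * nestedCenter (fun i => ν (i + 1)) k := by
  rw [nestedCenter, Finset.sum_range_succ', nestedCenter, Finset.mul_sum, add_comm]
  congr 1
  · simp [nestedRadius]
  · refine Finset.sum_congr rfl fun j _ => ?_
    rw [nestedRadius_succ', mul_assoc]

theorem summable_nested (ν : ℕ → ℕ) : Summable fun j => nestedRadius ν j * cellCenter (ν j) := by
  refine .of_nonneg_of_le
    (fun j => mul_nonneg (nestedRadius_nonneg ν j) (cellCenter_pos _).le) (fun j => ?_)
    summable_geometric_two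
  calc nestedRadius ν j * cellCenter (ν j) ≤ (1 / 2) ^ j * 1 :=
        mul_le_mul (nestedRadius_le ν j) (by linarith [cellCenter_le (ν j)])
          (cellCenter_pos _).le (by positivity)
    _ = _ := mul_one _

theorem nestedLimit_eq (ν : ℕ → ℕ) :
    nestedLimit ν = cellCenter (ν 0) + cellRadius (ν 0) * nestedLimit fun i => ν (i + 1) := by
  rw [nestedLimit, (summable_nested ν).tsum_eq_zero_add, nestedLimit, ← tsum_mul_left]
  congr 1
  · simp [nestedRadius]
  · refine tsum_congr fun j => ?_
    rw [nestedRadius_succ', mul_assoc]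

theorem nestedCenter_mem (ν : ℕ → ℕ) (k : ℕ) : nestedCenter ν k ∈ Icc (0 : ℝ) (3 / 8) := by
  induction k generalizing ν with
  | zero => simp [nestedCenter]; norm_num
  | succ k ih =>
    have h := ih fun i => ν (i + 1)
    have h1 := cellRadius_pos (ν 0)
    have h2 := cellRadius_le (ν 0)
    have h3 := cellCenter_pos (ν 0)
    have h4 := cellCenter_le (ν 0)
    rw [nestedCenter_succ']
    constructor <;> nlinarith [h.1, h.2]

theorem nestedLimit_mem (ν : ℕ → ℕ) : nestedLimit ν ∈ Icc (0 : ℝ) (3 / 8) :=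
  isClosed_Icc.mem_of_tendsto (summable_nested ν).hasSum.tendsto_sum_nat
    (Eventually.of_forall (nestedCenter_mem ν))

theorem abs_nestedCenter_sub_nestedLimit_le (ν : ℕ → ℕ) (k : ℕ) :
    |nestedCenter ν k - nestedLimit ν| ≤ (1 / 2) ^ k := by
  induction k generalizing ν with
  | zero =>
    have := nestedLimit_mem ν
    rw [nestedCenter, Finset.sum_range_zero, zero_sub, abs_neg, abs_of_nonneg this.1]
    linarith [this.2]
  | succ k ih =>
    rw [nestedCenter_succ', nestedLimit_eq, add_sub_add_left_eq_sub, ← mul_sub, abs_mul,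
      abs_of_pos (cellRadius_pos _), pow_succ, mul_comm]
    exact mul_le_mul (ih _) ((cellRadius_le _).trans (by norm_num)) (cellRadius_pos _).le
      (by positivity)

/-- The labels of the branch of a tree that is followed along `ν`. -/
def labels (ν : ℕ → ℕ) (i : ℕ) : ℕ := (Nat.unpair (ν i)).1

theorem treeSlope_cell {T : Set (List ℕ)} (hT : [] ∈ T) (n : ℕ) {t : ℝ}
    (ht : t ∈ Icc (0 : ℝ) (3 / 8)) :
    treeSlope T (cellCenter n + cellRadius n * t) =
      1 / 4 + (1 / 2) * treeSlope (subtree T n) t := by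
  have h1 : |cellCoord n (cellCenter n + cellRadius n * t)| ≤ 1 := by
    rw [cellCoord_center_add, abs_le]
    constructor <;> linarith [ht.1, ht.2]
  have h2 := mem_Icc_of_abs_cellCoord_le h1
  have h3 := cellCenter_pos n
  have h4 := cellCenter_le n
  rw [treeSlope_eq hT fun m hm => one_lt_abs_cellCoord hm h1, cellCoord_center_add,
    deriv_bumpProfile_of_lt]
  rw [abs_of_nonneg (by linarith [h2.1])]
  linarith [h2.2]

theorem initialSegment_labels_mem_subtree {T : Set (List ℕ)} {ν : ℕ → ℕ} {k : ℕ}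
    (h : initialSegment (labels ν) (k + 1) ∈ T) :
    initialSegment (labels fun i => ν (i + 1)) k ∈ subtree T (ν 0) := by
  rw [initialSegment_succ] at h
  exact h

/-- The values are the iterates of `s ↦ 1/4 + s/2` starting from `1/4`. -/
theorem treeSlope_nestedCenter {T : Set (List ℕ)} {ν : ℕ → ℕ} {k : ℕ}
    (h : ∀ j ≤ k, initialSegment (labels ν) j ∈ T) :
    treeSlope T (nestedCenter ν k) = 1 / 2 - (1 / 4) * (1 / 2) ^ k := by
  induction k generalizing T ν with
  | zero =>
    rw [nestedCenter, Finset.sum_range_zero, treeSlope_zero (h 0 le_rfl)]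
    norm_num
  | succ k ih =>
    rw [nestedCenter_succ', treeSlope_cell (h 0 (by omega)) _ (nestedCenter_mem _ k),
      ih fun j hj => initialSegment_labels_mem_subtree (h (j + 1) (by omega)), pow_succ]
    ring

/-- Continuity at the limit is not available. Instead, each step into a cell halves the distance of
the slope from the fixed point `1/2`, and slopes are uniformly bounded over all trees. -/
theorem treeSlope_nestedLimit {T : Set (List ℕ)} {ν : ℕ → ℕ}
    (h : ∀ j, initialSegment (labels ν) j ∈ T) : treeSlope T (nestedLimit ν) = 1 / 2 := by
  obtain ⟨C, hC⟩ := exists_abs_treeSlope_le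
  have key : ∀ (k : ℕ) (T : Set (List ℕ)) (ν : ℕ → ℕ), (∀ j, initialSegment (labels ν) j ∈ T) →
      |treeSlope T (nestedLimit ν) - 1 / 2| ≤ (C + 1 / 2) * (1 / 2) ^ k := by
    intro k
    induction k with
    | zero =>
      intro T ν _
      have := hC T (nestedLimit ν)
      rw [abs_le] at this ⊢
      constructor <;> linarith [this.1, this.2]
    | succ k ih =>
      intro T ν h
      have h1 := ih _ _ fun j => initialSegment_labels_mem_subtree (h (j + 1))
      rw [nestedLimit_eq, treeSlope_cell (h 0) _ (nestedLimit_mem _), pow_succ]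
      rw [abs_le] at h1 ⊢
      constructor <;> linarith [h1.1, h1.2]
  have hlim : Tendsto (fun k : ℕ => (C + 1 / 2) * (1 / 2 : ℝ) ^ k) atTop (𝓝 ((C + 1 / 2) * 0)) :=
    (tendsto_pow_atTop_nhds_zero_of_lt_one (by norm_num) (by norm_num)).const_mul _
  have h0 := ge_of_tendsto' hlim fun k => key k T ν h
  rw [mul_zero] at h0
  exact sub_eq_zero.1 (abs_eq_zero.1 (le_antisymm h0 (abs_nonneg _)))

theorem nestedRadius_congr {ν μ : ℕ → ℕ} {k : ℕ} (h : ∀ i < k, ν i = μ i) :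
    nestedRadius ν k = nestedRadius μ k :=
  Finset.prod_congr rfl fun i hi => by rw [h i (Finset.mem_range.1 hi)]

theorem nestedCenter_congr {ν μ : ℕ → ℕ} {k : ℕ} (h : ∀ i < k, ν i = μ i) :
    nestedCenter ν k = nestedCenter μ k :=
  Finset.sum_congr rfl fun j hj => by
    have hj := Finset.mem_range.1 hj
    rw [h j hj, nestedRadius_congr fun i hi => h i (hi.trans hj)]

theorem exists_isOscillationWitness_of_branch {T : Set (List ℕ)} {β : ℕ → ℕ}
    (hβ : ∀ k, initialSegment β k ∈ T) :
    ∃ x u z, IsOscillationWitness (fun t : unitInterval => treeSlope T t) x u z := by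
  let ν : ℕ → ℕ := fun i => Nat.pair (β i) 0
  -- `μ n m` follows the same labels but enters another copy of the subtree at step `n`. As `m`
  -- grows, these copies shrink to the `n`-th centre, while the slope at their own centres stays the
  -- same.
  let μ : ℕ → ℕ → ℕ → ℕ := fun n m i => Nat.pair (β i) (if i = n then n + m else 0)
  have hν : labels ν = β := funext fun i => by simp [labels, ν]
  have hμ : ∀ n m, labels (μ n m) = β := fun n m => funext fun i => by simp [labels, μ]
  have hμν : ∀ n m, ∀ i < n, μ n m i = ν i := fun n m i hi => by simp [μ, ν, hi.ne]
  have hI : ∀ t ∈ Icc (0 : ℝ) (3 / 8), t ∈ unitInterval := fun t ht =>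
    ⟨ht.1, ht.2.trans (by norm_num)⟩
  have hfx : treeSlope T (nestedLimit ν) = 1 / 2 := treeSlope_nestedLimit (by rwa [hν])
  have hfu : ∀ n, treeSlope T (nestedCenter ν n) = 1 / 2 - (1 / 4) * (1 / 2) ^ n := fun n =>
    treeSlope_nestedCenter fun j _ => by rw [hν]; exact hβ j
  have hfz : ∀ n m, treeSlope T (nestedCenter (μ n m) (n + 1)) =
      1 / 2 - (1 / 4) * (1 / 2) ^ (n + 1) := fun n m =>
    treeSlope_nestedCenter fun j _ => by rw [hμ]; exact hβ j
  have hpow : ∀ n : ℕ, 0 < (1 / 2 : ℝ) ^ n := fun n => by positivity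
  refine ⟨⟨nestedLimit ν, hI _ (nestedLimit_mem ν)⟩,
    fun n => ⟨nestedCenter ν n, hI _ (nestedCenter_mem ν n)⟩,
    fun n m => ⟨nestedCenter (μ n m) (n + 1), hI _ (nestedCenter_mem _ _)⟩,
    fun n => ?_, fun n m => ?_, fun n => ⟨?_, fun m => ?_⟩, fun n => ?_, fun j => ?_⟩
  · exact abs_nestedCenter_sub_nestedLimit_le ν n
  · change |nestedCenter (μ n m) (n + 1) - nestedCenter ν n| ≤ _
    rw [nestedCenter_succ,
      nestedCenter_congr (hμν n m), add_sub_cancel_left,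
      abs_of_nonneg (mul_nonneg (nestedRadius_nonneg _ _) (cellCenter_pos _).le), pow_add]
    refine mul_le_mul (nestedRadius_le _ _) ?_ (cellCenter_pos _).le (hpow n).le
    refine pow_le_pow_of_le_one (by norm_num) (by norm_num) ?_
    have : n + m ≤ μ n m n := by simpa [μ] using Nat.right_le_pair (β n) (n + m)
    omega
  · refine dist_pos.2 fun h => ?_
    have h1 := hfu n
    have h2 : nestedCenter ν n = nestedLimit ν := congrArg Subtype.val h
    rw [h2, hfx] at h1
    linarith [hpow n]
  · refine dist_pos.2 fun h => ?_
    have h1 := hfz n m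
    have h2 : nestedCenter (μ n m) (n + 1) = nestedLimit ν := congrArg Subtype.val h
    rw [h2, hfx] at h1
    linarith [hpow (n + 1)]
  -- The jump is exactly `(1/4) * (1/2) ^ (n + 1)`.
  · refine ⟨n + 3, fun m => ?_⟩
    simp only [hfu, hfz]
    refine le_trans (le_of_eq ?_) (le_abs_self _)
    ring
  · refine ⟨j, fun n hn => ?_⟩
    have h1 := pow_le_pow_of_le_one (by norm_num : (0 : ℝ) ≤ 1 / 2) (by norm_num) hn
    have h2 := hpow n
    simp only [hfu, hfz, hfx, abs_le, pow_succ]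
    refine ⟨⟨?_, ?_⟩, fun _ => ⟨?_, ?_⟩⟩ <;> linarith

end Branches

/-! ### The Borel reduction from trees to functions. -/

section TreeFunction

/-- The continuous function on `[0,1]` attached to a tree. -/
noncomputable def treeFunction (T : Set (List ℕ)) : C(unitInterval, ℝ) where
  toFun t := 1 / 2 + treePotential T t
  continuous_toFun := continuous_const.add
    ((continuous_iff_continuousAt.2 fun x => (hasDerivAt_treePotential T x).continuousAt).comp
      continuous_subtype_val)

theorem hasDerivWithinAt_treeFunction (T : Set (List ℕ)) {x : ℝ} (hx : x ∈ Icc (0 : ℝ) 1) :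
    HasDerivWithinAt (IccExtend zero_le_one (treeFunction T)) (treeSlope T x) (Icc 0 1) x := by
  have h : ∀ w ∈ Icc (0 : ℝ) 1,
      IccExtend zero_le_one (treeFunction T) w = 1 / 2 + treePotential T w := fun w hw => by
    rw [IccExtend_of_mem _ _ hw]; rfl
  exact ((hasDerivAt_treePotential T x).const_add (1 / 2)).hasDerivWithinAt.congr h (h x hx)

theorem unitDeriv_treeFunction (T : Set (List ℕ)) :
    unitDeriv (treeFunction T) = fun t : unitInterval => treeSlope T t :=
  funext fun t => unitDeriv_eq_of_hasDerivWithinAt _ (hasDerivWithinAt_treeFunction T t.2)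

theorem treeFunction_mem_differentiableFunctions (T : Set (List ℕ)) {J : Set ℝ}
    (hJ : Icc 0 1 ⊆ J) : treeFunction T ∈ differentiableFunctions J := by
  refine ⟨fun x => hJ ?_, fun x hx => (hasDerivWithinAt_treeFunction T hx).differentiableWithinAt⟩
  have h := abs_le.1 (abs_treePotential_le T x)
  change 1 / 2 + treePotential T x ∈ Icc (0 : ℝ) 1
  constructor <;> linarith [h.1, h.2]

theorem HasSolvableSlope.isClosed_discontinuitySet {T : Set (List ℕ)} (h : HasSolvableSlope T)
    {K : Set unitInterval} (hK : IsClosed K) :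
    IsClosed (discontinuitySet (fun t : unitInterval => treeSlope T t) K) := by
  have hK' : IsClosed ((fun t : unitInterval => (t : ℝ)) '' K) :=
    isClosed_Icc.isClosedEmbedding_subtypeVal.isClosedMap K hK
  have h1 := (h.2 _ hK').preimage (continuous_subtype_val : Continuous fun t : unitInterval => (t : ℝ))
  convert! h1 using 1
  ext x
  simp only [discontinuitySet, mem_ofPred_eq, mem_preimage,
    IsEmbedding.subtypeVal.continuousWithinAt_comp_iff (f := treeSlope T),
    Subtype.val_injective.mem_set_image]

theorem treeFunction_mem_solvableFunctions_iff (T : Set (List ℕ)) {J : Set ℝ}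
    (hJ : Icc 0 1 ⊆ J) :
    treeFunction T ∈ solvableFunctions J ↔ ¬ ∃ β : ℕ → ℕ, ∀ k, initialSegment β k ∈ T := by
  have hd := treeFunction_mem_differentiableFunctions T hJ
  constructor
  · rintro ⟨-, -, hs⟩ ⟨β, hβ⟩
    rw [unitDeriv_treeFunction] at hs
    obtain ⟨x, u, z, hw⟩ := exists_isOscillationWitness_of_branch hβ
    obtain ⟨K, hK, hKf⟩ := hw.exists_not_isClosed
    exact hKf (hs.2 K hK)
  · intro h
    have hT : HasSolvableSlope T := by
      by_contra hT
      exact h (exists_branch_of_not_hasSolvableSlope hT)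
    refine ⟨hd, ?_, isBaireOne_unitDeriv _ hd.2, fun K hK => ?_⟩
    · obtain ⟨C, hC⟩ := exists_abs_treeSlope_le
      rw [isBounded_iff_forall_norm_le, unitDeriv_treeFunction]
      exact ⟨C, forall_mem_range.2 fun x => hC T x⟩
    · rw [unitDeriv_treeFunction]
      exact hT.isClosed_discontinuitySet hK

variable {Ω : Type*} [MeasurableSpace Ω]

/-- For fixed `x` the only cell that can contribute does not depend on the tree. -/
theorem measurable_layer {h : ℝ → ℝ} {w : ℕ → ℝ} (hh : ∀ x, 1 < |x| → h x = 0) (k : ℕ)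
    {T : Ω → Set (List ℕ)} (hT : ∀ s, MeasurableSet {a | s ∈ T a}) (x : ℝ) :
    Measurable fun a => layer h w k (T a) x := by
  classical
  induction k generalizing T x with
  | zero => exact Measurable.ite (hT []) measurable_const measurable_const
  | succ k ih =>
    obtain ⟨n, hn⟩ := exists_forall_ne_one_lt_abs_cellCoord x
    have h1 : (fun a => layer h w (k + 1) (T a) x) = fun a => if [] ∈ T a then
        (1 / 2) * (w n * layer h w k (subtree (T a) n) (cellCoord n x)) else 0 := by
      ext a
      split_ifs with ha
      · exact layer_succ hh k ha hn
      · exact layer_of_nil_notMem _ ha x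
    rw [h1]
    have h2 : Measurable fun a => layer h w k (subtree (T a) n) (cellCoord n x) :=
      ih (T := fun a => subtree (T a) n) (fun s => hT _) _
    exact Measurable.ite (hT []) ((h2.const_mul _).const_mul _) measurable_const

theorem measurable_treePotential {T : Ω → Set (List ℕ)}
    (hT : ∀ s, MeasurableSet {a | s ∈ T a}) (x : ℝ) :
    Measurable fun a => treePotential (T a) x := by
  refine measurable_of_tendsto_metrizable
    (f := fun N a => ∑ k ∈ Finset.range N, layer bumpProfile cellRadius k (T a) x)
    (fun N => Finset.measurable_fun_sum _ fun k _ =>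
      measurable_layer (fun _ => bumpProfile_of_one_lt) k hT x)
    (tendsto_pi_nhds.2 fun a => ?_)
  exact (summable_layer (fun _ => bumpProfile_of_one_lt) abs_bumpProfile_le
    abs_cellRadius_le_one (T a) x).hasSum.tendsto_sum_nat

/-- Evaluation on a dense sequence is a continuous injection between Polish spaces, hence a Borel
embedding. -/
theorem measurable_continuousMap_of_eval {X : Type*} [TopologicalSpace X] [CompactSpace X]
    [TopologicalSpace.MetrizableSpace X] [Nonempty X] [MeasurableSpace C(X, ℝ)] [BorelSpace C(X, ℝ)]
    {F : Ω → C(X, ℝ)} (hF : ∀ x, Measurable fun a => F a x) : Measurable F := by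
  let := TopologicalSpace.metrizableSpaceMetric X
  have hc : Continuous fun (g : C(X, ℝ)) (n : ℕ) => g (TopologicalSpace.denseSeq X n) :=
    continuous_pi fun n => ContinuousEvalConst.continuous_eval_const _
  have hi : Function.Injective
      fun (g : C(X, ℝ)) (n : ℕ) => g (TopologicalSpace.denseSeq X n) := fun g₁ g₂ h => by
    refine DFunLike.coe_injective ((TopologicalSpace.denseRange_denseSeq X).equalizer
      g₁.continuous g₂.continuous (funext fun n => ?_))
    exact congrFun h n
  exact (hc.measurableEmbedding hi).measurable_comp_iff.1 (measurable_pi_iff.2 fun n => hF _)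

theorem measurable_treeFunction [MeasurableSpace C(unitInterval, ℝ)]
    [BorelSpace C(unitInterval, ℝ)] {T : Ω → Set (List ℕ)}
    (hT : ∀ s, MeasurableSet {a | s ∈ T a}) : Measurable fun a => treeFunction (T a) :=
  measurable_continuousMap_of_eval fun x => (measurable_treePotential hT x).const_add _

end TreeFunction

/-! ### Diagonalization over codes of analytic sets. -/

section Diagonal

theorem initialSegment_eq_iff {x y : ℕ → ℕ} {k l : ℕ} :
    initialSegment x k = initialSegment y l ↔ k = l ∧ ∀ i < k, x i = y i := by
  constructor
  · intro h
    obtain rfl : k = l := by simpa [initialSegment] using congrArg List.length h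
    exact ⟨rfl, by simpa [initialSegment] using h⟩
  · rintro ⟨rfl, h⟩
    simpa [initialSegment] using h

/-- The pairs of finite sequences of equal length coded by `a`. -/
def codedPairs (a : ℕ → ℕ) : Set (List ℕ × List ℕ) := {p | a (Encodable.encode p) = 1}

/-- For `A` the range of a continuous `g`, the code lists the initial segments of the points `(g β,
β)`. A pair all of whose initial segments are listed is a limit of such points, so it lies on the
graph, which is closed. -/
theorem MeasureTheory.AnalyticSet.exists_code {A : Set (ℕ → ℕ)} (hA : AnalyticSet A) :
    ∃ a, ∀ x, x ∈ A ↔ ∃ β : ℕ → ℕ, ∀ k, (initialSegment x k, initialSegment β k) ∈ codedPairs a := by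
  classical
  rw [AnalyticSet] at hA
  rcases hA with rfl | ⟨g, hg, rfl⟩
  · exact ⟨fun _ => 0, by simp [codedPairs]⟩
  · refine ⟨fun m => if ∃ β l, m = Encodable.encode (initialSegment (g β) l, initialSegment β l)
      then 1 else 0, fun x => ?_⟩
    simp only [codedPairs, mem_ofPred_eq, ite_eq_left_iff, zero_ne_one, imp_false, not_not,
      Encodable.encode_inj, Prod.mk.injEq, initialSegment_eq_iff]
    constructor
    · rintro ⟨β, rfl⟩
      exact ⟨β, fun k => ⟨β, k, by simp⟩⟩
    · rintro ⟨β, h⟩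
      choose γ l h1 h2 using h
      refine ⟨β, ?_⟩
      have hlim : ∀ {u : ℕ → ℕ → ℕ} {v : ℕ → ℕ}, (∀ k, ∀ i < k, v i = u k i) →
          Tendsto u atTop (𝓝 v) := fun {u v} h => tendsto_pi_nhds.2 fun i =>
        tendsto_const_nhds.congr' ((eventually_gt_atTop i).mono fun k hk => h k i hk)
      exact tendsto_nhds_unique ((hg.tendsto β).comp (hlim fun k => (h2 k).2))
        (hlim fun k => (h1 k).2)

/-- The tree of the attempts to find a witness that `a` belongs to the analytic set coded by
`a`. -/
def diagonalTree (a : ℕ → ℕ) : Set (List ℕ) :=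
  {s | (initialSegment a s.length, s) ∈ codedPairs a}

theorem initialSegment_mem_diagonalTree {a β : ℕ → ℕ} {k : ℕ} :
    initialSegment β k ∈ diagonalTree a ↔
      (initialSegment a k, initialSegment β k) ∈ codedPairs a := by
  simp [diagonalTree, initialSegment]

/-- A code `a` of this set would belong to it iff `diagonalTree a` has a branch, that is, iff it
does not belong. -/
theorem not_analyticSet_compl_diagonal :
    ¬ MeasureTheory.AnalyticSet
      {a : ℕ → ℕ | ¬ ∃ β : ℕ → ℕ, ∀ k, initialSegment β k ∈ diagonalTree a} := by
  intro h
  obtain ⟨a, ha⟩ := h.exists_code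
  have := ha a
  simp only [mem_ofPred_eq, initialSegment_mem_diagonalTree] at this
  tauto

/-- Membership of `s` depends on finitely many coordinates near `a`: the first `s.length`, and the
one holding the code of the pair. -/
theorem measurableSet_mem_diagonalTree (s : List ℕ) :
    MeasurableSet {a : ℕ → ℕ | s ∈ diagonalTree a} := by
  have hopen : IsOpen {a : ℕ → ℕ | s ∈ diagonalTree a} := by
    rw [isOpen_iff_mem_nhds]
    intro a ha
    have h1 : ∀ i, ∀ᶠ b : ℕ → ℕ in 𝓝 a, b i = a i := fun i =>
      (continuous_apply (A := fun _ : ℕ => ℕ) i).continuousAt.eventually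
        (p := fun c => c = a i) (by simp)
    have h2 : ∀ᶠ b : ℕ → ℕ in 𝓝 a, ∀ i ∈ Finset.range s.length, b i = a i :=
      (Finset.range s.length).eventually_all.2 fun i _ => h1 i
    filter_upwards [h2, h1 (Encodable.encode (initialSegment a s.length, s))] with b hb hb'
    have h3 : initialSegment b s.length = initialSegment a s.length :=
      initialSegment_eq_iff.2 ⟨rfl, fun i hi => hb i (Finset.mem_range.2 hi)⟩
    simp only [diagonalTree, codedPairs, mem_ofPred_eq] at ha ⊢
    rw [h3, hb', ha]
  exact hopen.measurableSet

theorem not_measurableSet_solvableFunctions {J : Set ℝ} (hJ : Icc 0 1 ⊆ J) :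
    ¬ MeasurableSet[borel C(unitInterval, ℝ)] (solvableFunctions J) := by
  borelize C(unitInterval, ℝ)
  intro h
  have h1 := (measurable_treeFunction measurableSet_mem_diagonalTree) h
  refine not_analyticSet_compl_diagonal ?_
  convert! h1.analyticSet using 1
  ext a
  exact (treeFunction_mem_solvableFunctions_iff _ hJ).symm

end Diagonal

theorem mainTheorem4 :
    (IsCoanalytic (solvableFunctions (Icc 0 1)) ∧
      ¬ MeasurableSet[borel C(unitInterval, ℝ)] (solvableFunctions (Icc 0 1))) ∧
    (IsCoanalytic (solvableFunctions univ) ∧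
      ¬ MeasurableSet[borel C(unitInterval, ℝ)] (solvableFunctions univ)) :=
  ⟨⟨isCoanalytic_solvableFunctions measurableSet_Icc, not_measurableSet_solvableFunctions le_rfl⟩,
    isCoanalytic_solvableFunctions .univ, not_measurableSet_solvableFunctions (subset_univ _)⟩
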